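/- Fix an item and $N_c$ statistically identical, independent caches. At each cache the item is alternately absent and present, starting with an absence at time $0$; the absence durations are i.i.d. positive with finite mean, the presence durations are i.i.d. positive with finite mean, and all durations (within and across caches) are independent. Let $\rho$ be the long-run probability (limiting expected fraction of time) that the item is present in a given cache, and let $\lambda$ be the rate at which the item enters a given cache while it is absent from it (the limit of the expected number of entries divided by the expected time of absence, i.e. the reciprocal of the mean absence duration). A controller keeps a perceived state (present/absent) for each cache. A reporting policy chooses, for each cache, a probability $u_1$ with which each entry of the item is reported, a probability $u_2$ with which each exit is reported, and a probability that the initial perceived state is "present"; all these random decisions are independent of each other and of the durations. A reported change (an update) instantly sets the perceived state of that cache to its true state; at an unreported change the perceived state is kept. For a policy, let $D_1$ (resp. $D_2$) be the long-run probability that the item is present but perceived absent (resp. absent but perceived present) at a given cache, and let the total update rate be the long-run expected number of updates per unit time sent by all $N_c$ caches together; these limits exist for every policy. Let $\epsilon_1,\epsilon_2\ge 0$, and let $R(\epsilon_1,\epsilon_2)$ be the minimum total update rate over all policies with $D_1\le\epsilon_1$ and $D_2\le\epsilon_2$ at every cache. If $\epsilon_1<\rho<1-\epsilon_2$ and $\epsilon_1(1-\rho)+\epsilon_2\rho<\rho(1-\rho)$,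 then the minimum exists and $$R(\epsilon_1,\epsilon_2)= N_c\,\lambda\,(1-\rho)\left\{2-\frac{\epsilon_1(1-\rho)}{\rho(1-\rho-\epsilon_2)}-\frac{\epsilon_2\,\rho}{(1-\rho)(\rho-\epsilon_1)}\right\};$$ in particular every policy meeting the distortion criterion has total update rate at least the right-hand side. Otherwise no update is needed: $R(\epsilon_1,\epsilon_2)=0$, and some policy meets the criterion while almost surely never sending an update. -/

import Mathlib

open MeasureTheory ProbabilityTheory Filter Topology
open scoped ENNReal

namespace CacheUpdate

/-- The elementary random variables, for one fixed item and caches `0, …, Nc - 1`: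
the length of the `m`-th period in which the item is absent from cache `j`, the length of the
`m`-th period in which it is present there, the coins that decide whether the `m`-th entry
(change from absent to present) and the `m`-th exit (change from present to absent) at cache `j`
are reported, and the coin for the state that the controller initially assigns to cache `j`. -/
inductive Source (Nc : ℕ) : Type
  | absence (j : Fin Nc) (m : ℕ)
  | presence (j : Fin Nc) (m : ℕ)
  | entryCoin (j : Fin Nc) (m : ℕ)
  | exitCoin (j : Fin Nc) (m : ℕ)
  | initCoin (j : Fin Nc)

/-- Laws of positive random durations with finite mean. -/
structure IsDurationLaw (ν : Measure ℝ) : Prop where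
  prob : IsProbabilityMeasure ν
  pos : ν (Set.Iic 0) = 0
  integrable : Integrable (fun x : ℝ => x) ν

/-- The uniform distribution on `[0, 1]`. -/
noncomputable def uniformLaw : Measure ℝ := volume.restrict (Set.Icc 0 1)

/-- `Nc` statistically identical, independent caches: at every cache the absence periods are
i.i.d. with law `νY`, the presence periods are i.i.d. with law `νZ`, the coins are uniform on
`[0, 1]`, and everything is independent. -/
structure IsCacheNetwork {Ω : Type*} [MeasurableSpace Ω] {Nc : ℕ} (μ : Measure Ω)
    (νY νZ : Measure ℝ) (X : Source Nc → Ω → ℝ) : Prop where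
  measurable : ∀ s, Measurable (X s)
  law_absence : ∀ j m, μ.map (X (.absence j m)) = νY
  law_presence : ∀ j m, μ.map (X (.presence j m)) = νZ
  law_entryCoin : ∀ j m, μ.map (X (.entryCoin j m)) = uniformLaw
  law_exitCoin : ∀ j m, μ.map (X (.exitCoin j m)) = uniformLaw
  law_initCoin : ∀ j, μ.map (X (.initCoin j)) = uniformLaw
  indep : iIndepFun X μ

/-- A reporting policy: at cache `j` each entry is reported with probability `entryProb j`, each
exit is reported with probability `exitProb j`, and the controller initially believes that the
item is present with probability `initProb j`. -/
structure Policy (Nc : ℕ) where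
  entryProb : Fin Nc → Set.Icc (0 : ℝ) 1
  exitProb : Fin Nc → Set.Icc (0 : ℝ) 1
  initProb : Fin Nc → Set.Icc (0 : ℝ) 1

variable {Ω : Type*} {Nc : ℕ}

/-- Start of the `m`-th absence period at cache `j`; the process starts at time `0` with an
absence period, and absence and presence periods alternate. -/
def startTime (X : Source Nc → Ω → ℝ) (j : Fin Nc) (m : ℕ) (ω : Ω) : ℝ :=
  ∑ k ∈ Finset.range m, (X (.absence j k) ω + X (.presence j k) ω)

/-- Time of the `m`-th entry of the item into cache `j`. -/
def entryTime (X : Source Nc → Ω → ℝ) (j : Fin Nc) (m : ℕ) (ω : Ω) : ℝ :=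
  startTime X j m ω + X (.absence j m) ω

/-- Time of the `m`-th exit of the item from cache `j`. -/
def exitTime (X : Source Nc → Ω → ℝ) (j : Fin Nc) (m : ℕ) (ω : Ω) : ℝ :=
  startTime X j (m + 1) ω

/-- The item is in cache `j` at time `t`. -/
def Present (X : Source Nc → Ω → ℝ) (j : Fin Nc) (t : ℝ) (ω : Ω) : Prop :=
  ∃ m, entryTime X j m ω ≤ t ∧ t < exitTime X j m ω

/-- The `m`-th entry at cache `j` is reported. -/
def EntryReported (P : Policy Nc) (X : Source Nc → Ω → ℝ) (j : Fin Nc) (m : ℕ) (ω : Ω) : Prop :=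
  X (.entryCoin j m) ω < P.entryProb j

/-- The `m`-th exit at cache `j` is reported. -/
def ExitReported (P : Policy Nc) (X : Source Nc → Ω → ℝ) (j : Fin Nc) (m : ℕ) (ω : Ω) : Prop :=
  X (.exitCoin j m) ω < P.exitProb j

/-- The controller believes, during the `m`-th absence period, that the item is in cache `j`.
A reported change sets the belief to the true state at once; an unreported change leaves the
belief as it was. -/
def BelievedDuringAbsence (P : Policy Nc) (X : Source Nc → Ω → ℝ) (j : Fin Nc) :
    ℕ → Ω → Prop
  | 0, ω => X (.initCoin j) ω < P.initProb j
  | m + 1, ω => ¬ ExitReported P X j m ω ∧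
      (EntryReported P X j m ω ∨ BelievedDuringAbsence P X j m ω)

/-- The controller believes, during the `m`-th presence period, that the item is in cache `j`. -/
def BelievedDuringPresence (P : Policy Nc) (X : Source Nc → Ω → ℝ) (j : Fin Nc) (m : ℕ)
    (ω : Ω) : Prop :=
  EntryReported P X j m ω ∨ BelievedDuringAbsence P X j m ω

/-- The controller believes at time `t` that the item is in cache `j`. -/
def Believed (P : Policy Nc) (X : Source Nc → Ω → ℝ) (j : Fin Nc) (t : ℝ) (ω : Ω) : Prop :=
  ∃ m, (startTime X j m ω ≤ t ∧ t < entryTime X j m ω ∧ BelievedDuringAbsence P X j m ω) ∨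
    (entryTime X j m ω ≤ t ∧ t < exitTime X j m ω ∧ BelievedDuringPresence P X j m ω)

/-- Number of entries into cache `j` up to time `w`. -/
noncomputable def entryCount (X : Source Nc → Ω → ℝ) (j : Fin Nc) (w : ℝ) (ω : Ω) : ℝ≥0∞ :=
  ∑' m, Set.indicator {ω' | entryTime X j m ω' ≤ w} 1 ω

/-- Number of updates that cache `j` sends up to time `w`. -/
noncomputable def updateCount (P : Policy Nc) (X : Source Nc → Ω → ℝ) (j : Fin Nc) (w : ℝ)
    (ω : Ω) : ℝ≥0∞ :=
  (∑' m, Set.indicator {ω' | entryTime X j m ω' ≤ w ∧ EntryReported P X j m ω'} 1 ω) +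
    ∑' m, Set.indicator {ω' | exitTime X j m ω' ≤ w ∧ ExitReported P X j m ω'} 1 ω

variable [MeasurableSpace Ω]

/-- Expected amount of time in `[0, w)` during which the condition `A` holds. -/
noncomputable def expectedTime (μ : Measure Ω) (A : ℝ → Ω → Prop) (w : ℝ) : ℝ≥0∞ :=
  ∫⁻ ω, volume {t : ℝ | 0 ≤ t ∧ t < w ∧ A t ω} ∂μ

/-- `A` has long-run probability `p`: the expected fraction of the time in `[0, w)` during which
`A` holds tends to `p` as `w → ∞`. -/
def HasLongRunProb (μ : Measure Ω) (A : ℝ → Ω → Prop) (p : ℝ) : Prop :=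
  0 ≤ p ∧ Tendsto (fun w : ℝ => expectedTime μ A w / ENNReal.ofReal w) atTop
    (𝓝 (ENNReal.ofReal p))

/-- The item, while it is absent, enters cache `j` at long-run rate `r`: the expected number of
entries up to time `w`, divided by the expected time of absence up to time `w`, tends to `r`. -/
def HasEntryRate (μ : Measure Ω) (X : Source Nc → Ω → ℝ) (j : Fin Nc) (r : ℝ) : Prop :=
  0 ≤ r ∧ Tendsto (fun w : ℝ => (∫⁻ ω, entryCount X j w ω ∂μ) /
    expectedTime μ (fun t ω => ¬ Present X j t ω) w) atTop (𝓝 (ENNReal.ofReal r))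

/-- The false-negative probability of policy `P` at cache `j` is `D`. -/
def HasDistortionI (μ : Measure Ω) (P : Policy Nc) (X : Source Nc → Ω → ℝ) (j : Fin Nc)
    (D : ℝ) : Prop :=
  HasLongRunProb μ (fun t ω => Present X j t ω ∧ ¬ Believed P X j t ω) D

/-- The false-positive probability of policy `P` at cache `j` is `D`. -/
def HasDistortionII (μ : Measure Ω) (P : Policy Nc) (X : Source Nc → Ω → ℝ) (j : Fin Nc)
    (D : ℝ) : Prop :=
  HasLongRunProb μ (fun t ω => ¬ Present X j t ω ∧ Believed P X j t ω) D

/-- Policy `P` satisfies the distortion criterion `(ε₁, ε₂)` at every cache. -/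
def MeetsDistortion (μ : Measure Ω) (P : Policy Nc) (X : Source Nc → Ω → ℝ) (ε₁ ε₂ : ℝ) : Prop :=
  ∀ j, (∃ D₁, HasDistortionI μ P X j D₁ ∧ D₁ ≤ ε₁) ∧
    (∃ D₂, HasDistortionII μ P X j D₂ ∧ D₂ ≤ ε₂)

/-- The expected number of updates per unit of time sent by all caches together, under policy
`P`, tends to `R`. -/
def HasTotalUpdateRate (μ : Measure Ω) (P : Policy Nc) (X : Source Nc → Ω → ℝ) (R : ℝ) : Prop :=
  0 ≤ R ∧ Tendsto (fun w : ℝ => (∫⁻ ω, ∑ j, updateCount P X j w ω ∂μ) / ENNReal.ofReal w) atTop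
    (𝓝 (ENNReal.ofReal R))

/-- The total update rates of the policies that satisfy the distortion criterion `(ε₁, ε₂)`. -/
def sufficientRates (μ : Measure Ω) (X : Source Nc → Ω → ℝ) (ε₁ ε₂ : ℝ) : Set ℝ :=
  {R | ∃ P : Policy Nc, MeetsDistortion μ P X ε₁ ε₂ ∧ HasTotalUpdateRate μ P X R}

end CacheUpdate

/-!
The belief of the controller about one cache, sampled at the successive absence periods, is a
two-state Markov chain driven by the coins alone. If entries are reported with probability `p` and
exits with probability `q`, the probability of a false belief passes from one absence period to the
next by the map `α ↦ (1 - q) (1 - (1 - p) (1 - α))`, and converges to a fixed point `α` of this map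
(`exists_tendsto_beliefProb`); the probability of a miss during a presence period then tends to
`x = (1 - p) (1 - α)`.

As the coins are independent of the durations, the expected time in falsely believed absence
periods is the sum of the expected lengths (cut off at the horizon) of the absence periods, the
`m`-th one weighted with the probability of a false belief. Each single period has bounded expected
length, so a convergent weight may be replaced by its limit (`tendsto_tsum_mul_div`,
`IsCacheNetwork.hasLongRunProb_marked`). This gives the distortions `D₁ = ρ x` and
`D₂ = (1 - ρ) α`. In the same way the updates are a thinning of the entries and exits. By the
definition of `lam` the entries occur at rate `lam (1 - ρ)` per unit of time, and so do the exits,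
which alternate with the entries; each cache therefore sends updates at rate
`lam (1 - ρ) (p + q)`. The long-run fraction `ρ` and the entry rate `lam` are given as limits, so no
renewal theorem is needed; finiteness of the expected number of entries also shows that the periods
exhaust the time axis almost surely (`IsCacheNetwork.ae_startTime_unbounded`).

What is left is an elementary optimization. With `a = ε₁ / ρ` and `b = ε₂ / (1 - ρ)` the criterion
reads `x ≤ a`, `α ≤ b`. If `a + b < 1`, stationarity gives `1 - p = x / (1 - α) ≤ a / (1 - b)` and
`1 - q = α / (1 - x) ≤ b / (1 - a)` (`stationary_cost_ge`), with equality for the policy that is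
started at `α = b` and makes both constraints tight. Otherwise a constant belief that is never
updated meets the criterion (`exists_constant_belief`).
-/

namespace CacheUpdate

/-! ### Weighted averages over time -/

lemma tendsto_const_div_ofReal {C : ℝ≥0∞} (hC : C ≠ ∞) :
    Tendsto (fun w : ℝ => C / ENNReal.ofReal w) atTop (𝓝 0) := by
  have h := ENNReal.Tendsto.const_div (a := C) ENNReal.tendsto_ofReal_atTop (Or.inr hC)
  simpa using h

lemma tendsto_tsum_mul_div_zero {d : ℕ → ℝ≥0∞} {B : ℝ≥0∞} (hB : B ≠ ∞) (hdB : ∀ m, d m ≤ B)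
    (hd : Tendsto d atTop (𝓝 0)) {T : ℕ → ℝ → ℝ≥0∞} {K : ℝ≥0∞} (hK : K ≠ ∞)
    (hT : ∀ m w, T m w ≤ K) {τ : ℝ≥0∞} (hτ : τ ≠ ∞)
    (hsum : Tendsto (fun w : ℝ => (∑' m, T m w) / ENNReal.ofReal w) atTop (𝓝 τ)) :
    Tendsto (fun w : ℝ => (∑' m, d m * T m w) / ENNReal.ofReal w) atTop (𝓝 0) := by
  rw [ENNReal.tendsto_nhds_zero]
  intro ε hε
  have hτ1 : τ + 1 ≠ ∞ := by simp [hτ]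
  have hτ0 : τ + 1 ≠ 0 := by simp
  have hε2 : 0 < ε / 2 := ENNReal.half_pos hε.ne'
  have hδ : 0 < ε / 2 / (τ + 1) := ENNReal.div_pos hε2.ne' hτ1
  obtain ⟨M, hM⟩ := eventually_atTop.1 (ENNReal.tendsto_nhds_zero.1 hd _ hδ)
  have hMBK : (M : ℝ≥0∞) * (B * K) ≠ ∞ :=
    ENNReal.mul_ne_top (ENNReal.natCast_ne_top M) (ENNReal.mul_ne_top hB hK)
  have h1 := ENNReal.tendsto_nhds_zero.1 (tendsto_const_div_ofReal hMBK) _ hε2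
  have h2 : ∀ᶠ w : ℝ in atTop, (∑' m, T m w) / ENNReal.ofReal w ≤ τ + 1 :=
    (hsum.eventually_lt_const (ENNReal.lt_add_right hτ one_ne_zero)).mono fun _ h => h.le
  filter_upwards [h1, h2] with w h1 h2
  -- the first `M` terms are bounded by a constant, the weights of the others are small
  have hle : ∑' m, d m * T m w ≤ M * (B * K) + ε / 2 / (τ + 1) * ∑' m, T m w := by
    calc ∑' m, d m * T m w
        ≤ ∑' m, ((if m ∈ Finset.range M then B * K else 0) + ε / 2 / (τ + 1) * T m w) := by
          refine ENNReal.tsum_le_tsum fun m => ?_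
          by_cases hm : m < M
          · rw [if_pos (Finset.mem_range.2 hm)]
            exact (mul_le_mul' (hdB m) (hT m w)).trans le_self_add
          · rw [if_neg (by simpa using hm), zero_add]
            exact mul_le_mul_left (hM m (not_lt.1 hm)) _
      _ = _ := by
          rw [ENNReal.tsum_add, ENNReal.tsum_mul_left]
          congr 1
          rw [tsum_eq_sum (s := Finset.range M) (fun m hm => if_neg hm),
            Finset.sum_congr rfl fun m hm => if_pos hm]
          simp
  calc (∑' m, d m * T m w) / ENNReal.ofReal w
      ≤ M * (B * K) / ENNReal.ofReal w
          + ε / 2 / (τ + 1) * ((∑' m, T m w) / ENNReal.ofReal w) := by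
        rw [← mul_div_assoc, ← ENNReal.add_div]
        exact ENNReal.div_le_div_right hle _
    _ ≤ ε / 2 + ε / 2 / (τ + 1) * (τ + 1) := by gcongr
    _ = ε := by rw [ENNReal.div_mul_cancel hτ0 hτ1, ENNReal.add_halves]

/-- Weights that converge can be replaced by their limit in a long-run time average, provided that
each single term contributes a bounded amount of time. -/
lemma tendsto_tsum_mul_div {c : ℕ → ℝ≥0∞} {γ : ℝ≥0∞} (hc1 : ∀ m, c m ≤ 1)
    (hc : Tendsto c atTop (𝓝 γ)) {T : ℕ → ℝ → ℝ≥0∞} {K : ℝ≥0∞} (hK : K ≠ ∞)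
    (hT : ∀ m w, T m w ≤ K) {τ : ℝ≥0∞} (hτ : τ ≠ ∞)
    (hsum : Tendsto (fun w : ℝ => (∑' m, T m w) / ENNReal.ofReal w) atTop (𝓝 τ)) :
    Tendsto (fun w : ℝ => (∑' m, c m * T m w) / ENNReal.ofReal w) atTop (𝓝 (γ * τ)) := by
  have hγ1 : γ ≤ 1 := le_of_tendsto' hc hc1
  have hγ : γ ≠ ∞ := ne_top_of_le_ne_top ENNReal.one_ne_top hγ1
  set d : ℕ → ℝ≥0∞ := fun m => (c m - γ) + (γ - c m) with hd_def
  have hd : Tendsto d atTop (𝓝 0) := by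
    have h := (ENNReal.Tendsto.sub hc (tendsto_const_nhds (x := γ)) (Or.inr hγ)).add
      (ENNReal.Tendsto.sub (tendsto_const_nhds (x := γ)) hc (Or.inr hγ))
    simpa using h
  have hdB : ∀ m, d m ≤ 2 := fun m =>
    (add_le_add (tsub_le_self.trans (hc1 m)) (tsub_le_self.trans hγ1)).trans_eq one_add_one_eq_two
  have hD := tendsto_tsum_mul_div_zero ENNReal.ofNat_ne_top hdB hd hK hT hτ hsum
  have hA : Tendsto (fun w : ℝ => γ * ((∑' m, T m w) / ENNReal.ofReal w)) atTop (𝓝 (γ * τ)) :=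
    ENNReal.Tendsto.const_mul hsum (Or.inr hγ)
  have hlow := ENNReal.Tendsto.sub hA hD (Or.inr ENNReal.zero_ne_top)
  have hup := hA.add hD
  rw [tsub_zero] at hlow
  rw [add_zero] at hup
  refine tendsto_of_tendsto_of_tendsto_of_le_of_le hlow hup (fun w => ?_) (fun w => ?_)
  · refine tsub_le_iff_right.2 ?_
    rw [← mul_div_assoc, ← ENNReal.tsum_mul_left, ← ENNReal.add_div, ← ENNReal.tsum_add]
    refine ENNReal.div_le_div_right (ENNReal.tsum_le_tsum fun m => ?_) _
    rw [← add_mul]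
    refine mul_le_mul_left ?_ _
    exact (le_add_tsub (a := γ) (b := c m)).trans (add_le_add le_rfl le_add_self)
  · change _ ≤ γ * ((∑' m, T m w) / ENNReal.ofReal w) + _
    rw [← mul_div_assoc, ← ENNReal.tsum_mul_left, ← ENNReal.add_div, ← ENNReal.tsum_add]
    refine ENNReal.div_le_div_right (ENNReal.tsum_le_tsum fun m => ?_) _
    rw [← add_mul]
    refine mul_le_mul_left ?_ _
    exact (le_add_tsub (a := c m) (b := γ)).trans (add_le_add le_rfl le_self_add)

/-! ### Time spent in a sequence of successive intervals -/

lemma eq_of_mem_Ico_of_mem_Ico {lo hi : ℕ → ℝ} (hlh : ∀ m, lo m ≤ hi m)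
    (hhl : ∀ m, hi m ≤ lo (m + 1)) {t : ℝ} {m n : ℕ} (hm : t ∈ Set.Ico (lo m) (hi m))
    (hn : t ∈ Set.Ico (lo n) (hi n)) : m = n := by
  have hmono : Monotone lo := monotone_nat_of_le_succ fun k => (hlh k).trans (hhl k)
  by_contra hne
  rcases lt_or_gt_of_ne hne with h | h
  · exact absurd ((hm.2.trans_le (hhl m)).trans_le (hmono (Nat.succ_le_of_lt h))) (not_lt.2 hn.1)
  · exact absurd ((hn.2.trans_le (hhl n)).trans_le (hmono (Nat.succ_le_of_lt h))) (not_lt.2 hm.1)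

open Classical in
lemma volume_setOf_exists_mem_Ico {lo hi : ℕ → ℝ} (hlh : ∀ m, lo m ≤ hi m)
    (hhl : ∀ m, hi m ≤ lo (m + 1)) (Q : ℕ → Prop) (w : ℝ) :
    volume {t : ℝ | 0 ≤ t ∧ t < w ∧ ∃ m, lo m ≤ t ∧ t < hi m ∧ Q m} =
      ∑' m, (if Q m then 1 else 0) * volume (Set.Ico 0 w ∩ Set.Ico (lo m) (hi m)) := by
  have hset : {t : ℝ | 0 ≤ t ∧ t < w ∧ ∃ m, lo m ≤ t ∧ t < hi m ∧ Q m} =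
      ⋃ m, if Q m then Set.Ico 0 w ∩ Set.Ico (lo m) (hi m) else ∅ := by
    ext t
    simp only [Set.mem_ofPred_eq, Set.mem_iUnion, Set.mem_ite_empty_right, Set.mem_inter_iff,
      Set.mem_Ico]
    constructor
    · rintro ⟨h0, hw, m, h1, h2, h3⟩
      exact ⟨m, h3, ⟨h0, hw⟩, h1, h2⟩
    · rintro ⟨m, h3, ⟨h0, hw⟩, h1, h2⟩
      exact ⟨h0, hw, m, h1, h2, h3⟩
  rw [hset, measure_iUnion]
  · refine tsum_congr fun m => ?_
    split_ifs <;> simp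
  · intro m n hmn
    rw [Function.onFun, Set.disjoint_left]
    intro t htm htn
    simp only [Set.mem_ite_empty_right, Set.mem_inter_iff] at htm htn
    exact hmn (eq_of_mem_Ico_of_mem_Ico hlh hhl htm.2.2 htn.2.2)
  · intro m
    split_ifs
    · exact measurableSet_Ico.inter measurableSet_Ico
    · exact MeasurableSet.empty

/-! ### The belief chain -/

/-- The probability that the controller believes, during the `m`-th absence period, that the item
is present, if entries are reported with probability `p`, exits with probability `q`, and the
initial belief is `present` with probability `u`. -/
def beliefProb (p q u : ℝ) : ℕ → ℝ
  | 0 => u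
  | m + 1 => (1 - q) * (1 - (1 - p) * (1 - beliefProb p q u m))

/-- `α` is a stationary value of the recursion that defines `beliefProb p q u`. -/
def IsStationaryBelief (p q α : ℝ) : Prop :=
  α = (1 - q) * (1 - (1 - p) * (1 - α))

lemma beliefProb_sub_stationary {p q α : ℝ} (hα : IsStationaryBelief p q α) (u : ℝ) (m : ℕ) :
    beliefProb p q u m - α = ((1 - p) * (1 - q)) ^ m * (u - α) := by
  induction m with
  | zero => simp [beliefProb]
  | succ k ih =>
    have hα' : α = (1 - q) * (1 - (1 - p) * (1 - α)) := hα
    rw [pow_succ', mul_assoc, ← ih, beliefProb]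
    linear_combination -hα'

lemma beliefProb_of_stationary {p q α : ℝ} (hα : IsStationaryBelief p q α) (m : ℕ) :
    beliefProb p q α m = α := by
  have h := beliefProb_sub_stationary hα α m
  simp only [sub_self, mul_zero] at h
  linarith

/-- The belief chain converges from every initial belief: it is a contraction, except that it is
constant if nothing is ever reported. -/
lemma exists_tendsto_beliefProb {p q u : ℝ} (hp : p ∈ Set.Icc (0 : ℝ) 1)
    (hq : q ∈ Set.Icc (0 : ℝ) 1) :
    ∃ α, IsStationaryBelief p q α ∧ Tendsto (beliefProb p q u) atTop (𝓝 α) := by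
  obtain ⟨hp0, hp1⟩ := hp
  obtain ⟨hq0, hq1⟩ := hq
  by_cases h : p = 0 ∧ q = 0
  · obtain ⟨rfl, rfl⟩ := h
    have hu : IsStationaryBelief 0 0 u := by simp [IsStationaryBelief]
    refine ⟨u, hu, ?_⟩
    rw [funext (beliefProb_of_stationary hu)]
    exact tendsto_const_nhds
  · have hr0 : 0 ≤ (1 - p) * (1 - q) := mul_nonneg (by linarith) (by linarith)
    have hr1 : (1 - p) * (1 - q) < 1 := by
      rcases hp0.lt_or_eq with hp' | hp'
      · nlinarith
      · rcases hq0.lt_or_eq with hq' | hq'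
        · nlinarith
        · exact absurd ⟨hp'.symm, hq'.symm⟩ h
    have hne : 1 - (1 - p) * (1 - q) ≠ 0 := by linarith
    obtain ⟨α, hα⟩ : ∃ α, IsStationaryBelief p q α := by
      refine ⟨(1 - q) * p / (1 - (1 - p) * (1 - q)), ?_⟩
      have h := div_mul_cancel₀ ((1 - q) * p) hne
      rw [IsStationaryBelief]
      linear_combination h
    refine ⟨α, hα, ?_⟩
    have hlim : Tendsto (fun m : ℕ => ((1 - p) * (1 - q)) ^ m * (u - α) + α) atTop
        (𝓝 (0 * (u - α) + α)) :=
      ((tendsto_pow_atTop_nhds_zero_of_lt_one hr0 hr1).mul_const _).add_const _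
    rw [zero_mul, zero_add] at hlim
    refine hlim.congr fun m => ?_
    rw [← beliefProb_sub_stationary hα u m, sub_add_cancel]

/-- The optimization behind the lower bound: `x` is the stationary probability of a miss during a
presence period and `α` that of a false belief during an absence period. They determine the
reporting probabilities, `1 - p = x / (1 - α)` and `1 - q = α / (1 - x)`, and the resulting cost
`p + q` decreases in both. -/
lemma stationary_cost_ge {p q α a b : ℝ} (hp : p ∈ Set.Icc (0 : ℝ) 1)
    (hq : q ∈ Set.Icc (0 : ℝ) 1) (hα : IsStationaryBelief p q α) (hα0 : 0 ≤ α) (hα1 : α ≤ 1)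
    (hxa : (1 - p) * (1 - α) ≤ a) (hαb : α ≤ b) (hab : a + b < 1) :
    2 - a / (1 - b) - b / (1 - a) ≤ p + q := by
  have hx0 : 0 ≤ (1 - p) * (1 - α) := mul_nonneg (by linarith [hp.2]) (by linarith)
  have hb1 : 0 < 1 - b := by linarith
  have ha1 : 0 < 1 - a := by linarith
  have h1 : 1 - p ≤ a / (1 - b) := by
    rw [le_div_iff₀ hb1]
    nlinarith [hp.2]
  have h2 : 1 - q ≤ b / (1 - a) := by
    rw [le_div_iff₀ ha1]
    have hα' : α = (1 - q) * (1 - (1 - p) * (1 - α)) := hα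
    nlinarith [hq.2]
  linarith

/-! ### Algebras generated by coins and durations -/

section Sources

variable {Ω : Type*} {Nc : ℕ}

/-- The σ-algebra generated by the elementary random variables with labels in `T`. -/
abbrev sourceAlgebra (X : Source Nc → Ω → ℝ) (T : Set (Source Nc)) : MeasurableSpace Ω :=
  ⨆ s ∈ T, MeasurableSpace.comap (X s) inferInstance

/-- The labels of the durations at cache `j`. -/
def durationSources (j : Fin Nc) : Set (Source Nc) :=
  {s | ∃ k, s = .absence j k ∨ s = .presence j k}

/-- The labels of the initial coin of cache `j` and of its entry and exit coins with index less
than `m`: the coins that determine the belief during the `m`-th absence period. -/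
def coinsBefore (j : Fin Nc) (m : ℕ) : Set (Source Nc) :=
  {s | s = .initCoin j ∨ ∃ k < m, s = .entryCoin j k ∨ s = .exitCoin j k}

lemma coinsBefore_mono (j : Fin Nc) : Monotone (coinsBefore j) := by
  rintro m n hmn s (hs | ⟨k, hk, hs⟩)
  · exact Or.inl hs
  · exact Or.inr ⟨k, hk.trans_le hmn, hs⟩

lemma disjoint_coinsBefore_durationSources (j : Fin Nc) (m : ℕ) :
    Disjoint (coinsBefore j m) (durationSources j) := by
  rw [Set.disjoint_left]
  rintro s (rfl | ⟨k, -, rfl | rfl⟩) ⟨l, hl⟩ <;> simp at hl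

lemma sourceAlgebra_mono (X : Source Nc → Ω → ℝ) {S T : Set (Source Nc)} (h : S ⊆ T) :
    sourceAlgebra X S ≤ sourceAlgebra X T :=
  biSup_mono h

lemma measurable_source (X : Source Nc → Ω → ℝ) {T : Set (Source Nc)} {s : Source Nc}
    (hs : s ∈ T) : Measurable[sourceAlgebra X T] (X s) :=
  (comap_measurable (X s)).mono
    (le_iSup₂ (f := fun s (_ : s ∈ T) => MeasurableSpace.comap (X s) inferInstance) s hs) le_rfl

lemma measurable_startTime {m₀ : MeasurableSpace Ω} {X : Source Nc → Ω → ℝ} {j : Fin Nc}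
    (h : ∀ s ∈ durationSources j, Measurable (X s)) (m : ℕ) : Measurable (startTime X j m) :=
  Finset.measurable_sum _ fun k _ =>
    (h _ ⟨k, Or.inl rfl⟩).add (h _ ⟨k, Or.inr rfl⟩)

lemma measurable_entryTime {m₀ : MeasurableSpace Ω} {X : Source Nc → Ω → ℝ} {j : Fin Nc}
    (h : ∀ s ∈ durationSources j, Measurable (X s)) (m : ℕ) : Measurable (entryTime X j m) :=
  (measurable_startTime h m).add (h _ ⟨m, Or.inl rfl⟩)

lemma measurableSet_entryReported (P : Policy Nc) (X : Source Nc → Ω → ℝ) (j : Fin Nc) (m : ℕ) :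
    MeasurableSet[sourceAlgebra X {.entryCoin j m}] {ω | EntryReported P X j m ω} :=
  measurable_source X (Set.mem_singleton _) measurableSet_Iio

lemma measurableSet_exitReported (P : Policy Nc) (X : Source Nc → Ω → ℝ) (j : Fin Nc) (m : ℕ) :
    MeasurableSet[sourceAlgebra X {.exitCoin j m}] {ω | ExitReported P X j m ω} :=
  measurable_source X (Set.mem_singleton _) measurableSet_Iio

lemma measurableSet_believedDuringAbsence (P : Policy Nc) (X : Source Nc → Ω → ℝ) (j : Fin Nc)
    (m : ℕ) :
    MeasurableSet[sourceAlgebra X (coinsBefore j m)] {ω | BelievedDuringAbsence P X j m ω} := by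
  induction m with
  | zero => exact measurable_source X (Or.inl rfl) measurableSet_Iio
  | succ m ih =>
    have h1 := sourceAlgebra_mono X (coinsBefore_mono j m.le_succ) _ ih
    have h2 := sourceAlgebra_mono X (T := coinsBefore j (m + 1)) (by
      rintro s rfl
      exact Or.inr ⟨m, m.lt_succ_self, Or.inl rfl⟩) _ (measurableSet_entryReported P X j m)
    have h3 := sourceAlgebra_mono X (T := coinsBefore j (m + 1)) (by
      rintro s rfl
      exact Or.inr ⟨m, m.lt_succ_self, Or.inr rfl⟩) _ (measurableSet_exitReported P X j m)
    exact MeasurableSet.inter (MeasurableSet.compl h3) (MeasurableSet.union h2 h1)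

lemma measurableSet_believedDuringPresence (P : Policy Nc) (X : Source Nc → Ω → ℝ) (j : Fin Nc)
    (m : ℕ) :
    MeasurableSet[sourceAlgebra X (coinsBefore j (m + 1) \ {.exitCoin j m})]
      {ω | BelievedDuringPresence P X j m ω} := by
  have h1 := sourceAlgebra_mono X (T := coinsBefore j (m + 1) \ {.exitCoin j m}) (by
    intro s hs
    refine ⟨coinsBefore_mono j m.le_succ hs, ?_⟩
    rintro rfl
    rcases hs with hs | ⟨k, hk, hs | hs⟩
    · simp at hs
    · simp at hs
    · simp only [Source.exitCoin.injEq, true_and] at hs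
      omega) _ (measurableSet_believedDuringAbsence P X j m)
  have h2 := sourceAlgebra_mono X (T := coinsBefore j (m + 1) \ {.exitCoin j m}) (by
    rintro s rfl
    exact ⟨Or.inr ⟨m, m.lt_succ_self, Or.inl rfl⟩, by simp⟩) _
    (measurableSet_entryReported P X j m)
  exact MeasurableSet.union h2 h1

end Sources

/-! ### Paths of the presence and belief processes -/

section Paths

variable {Ω : Type*} {Nc : ℕ} {X : Source Nc → Ω → ℝ} {j : Fin Nc}

lemma startTime_le_entryTime {ω : Ω}
    (h : ∀ m, 0 < X (.absence j m) ω ∧ 0 < X (.presence j m) ω) (m : ℕ) :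
    startTime X j m ω ≤ entryTime X j m ω :=
  le_add_of_nonneg_right (h m).1.le

lemma exitTime_eq (m : ℕ) (ω : Ω) :
    exitTime X j m ω = entryTime X j m ω + X (.presence j m) ω := by
  rw [exitTime, entryTime, startTime, Finset.sum_range_succ, ← add_assoc]
  rfl

lemma entryTime_le_exitTime {ω : Ω}
    (h : ∀ m, 0 < X (.absence j m) ω ∧ 0 < X (.presence j m) ω) (m : ℕ) :
    entryTime X j m ω ≤ exitTime X j m ω := by
  rw [exitTime_eq]
  exact le_add_of_nonneg_right (h m).2.le

lemma exitTime_le_entryTime_succ {ω : Ω}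
    (h : ∀ m, 0 < X (.absence j m) ω ∧ 0 < X (.presence j m) ω) (m : ℕ) :
    exitTime X j m ω ≤ entryTime X j (m + 1) ω :=
  startTime_le_entryTime h (m + 1)

lemma present_and_not_believed_iff {P : Policy Nc} {ω : Ω}
    (h : ∀ m, 0 < X (.absence j m) ω ∧ 0 < X (.presence j m) ω) (t : ℝ) :
    (Present X j t ω ∧ ¬ Believed P X j t ω) ↔ ∃ m, entryTime X j m ω ≤ t ∧
      t < exitTime X j m ω ∧ ¬ BelievedDuringPresence P X j m ω := by
  constructor
  · rintro ⟨⟨m, h1, h2⟩, hb⟩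
    exact ⟨m, h1, h2, fun hm => hb ⟨m, Or.inr ⟨h1, h2, hm⟩⟩⟩
  · rintro ⟨m, h1, h2, hm⟩
    refine ⟨⟨m, h1, h2⟩, ?_⟩
    rintro ⟨n, ⟨h3, h4, -⟩ | ⟨h3, h4, hn⟩⟩
    · have hmn : m = n := eq_of_mem_Ico_of_mem_Ico (lo := fun k => startTime X j k ω)
        (hi := fun k => exitTime X j k ω)
        (fun k => (startTime_le_entryTime h k).trans (entryTime_le_exitTime h k))
        (fun k => le_rfl) ⟨(startTime_le_entryTime h m).trans h1, h2⟩
        ⟨h3, h4.trans_le (entryTime_le_exitTime h n)⟩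
      subst hmn
      exact absurd h4 (not_lt.2 h1)
    · have hmn : m = n := eq_of_mem_Ico_of_mem_Ico (lo := fun k => entryTime X j k ω)
        (hi := fun k => exitTime X j k ω) (entryTime_le_exitTime h)
        (exitTime_le_entryTime_succ h) ⟨h1, h2⟩ ⟨h3, h4⟩
      subst hmn
      exact hm hn

lemma not_present_and_believed_iff {P : Policy Nc} {ω : Ω}
    (h : ∀ m, 0 < X (.absence j m) ω ∧ 0 < X (.presence j m) ω) (t : ℝ) :
    (¬ Present X j t ω ∧ Believed P X j t ω) ↔ ∃ m, startTime X j m ω ≤ t ∧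
      t < entryTime X j m ω ∧ BelievedDuringAbsence P X j m ω := by
  constructor
  · rintro ⟨hp, m, ⟨h1, h2, hm⟩ | ⟨h1, h2, -⟩⟩
    · exact ⟨m, h1, h2, hm⟩
    · exact absurd ⟨m, h1, h2⟩ hp
  · rintro ⟨m, h1, h2, hm⟩
    refine ⟨?_, m, Or.inl ⟨h1, h2, hm⟩⟩
    rintro ⟨n, h3, h4⟩
    have hmn : m = n := eq_of_mem_Ico_of_mem_Ico (lo := fun k => startTime X j k ω)
      (hi := fun k => exitTime X j k ω)
      (fun k => (startTime_le_entryTime h k).trans (entryTime_le_exitTime h k))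
      (fun k => le_rfl) ⟨h1, h2.trans_le (entryTime_le_exitTime h m)⟩
      ⟨(startTime_le_entryTime h n).trans h3, h4⟩
    subst hmn
    exact absurd h2 (not_lt.2 h3)

lemma not_present_iff {ω : Ω}
    (h : ∀ m, 0 < X (.absence j m) ω ∧ 0 < X (.presence j m) ω)
    (hub : ∀ t : ℝ, ∃ m, t < startTime X j m ω) {t : ℝ} (ht : 0 ≤ t) :
    ¬ Present X j t ω ↔ ∃ m, startTime X j m ω ≤ t ∧ t < entryTime X j m ω := by
  constructor
  · intro hp
    classical
    have hpos : Nat.find (hub t) ≠ 0 := by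
      intro h0
      have h1 := Nat.find_spec (hub t)
      rw [h0, startTime, Finset.sum_range_zero] at h1
      exact absurd h1 (not_lt.2 ht)
    obtain ⟨m, hm⟩ := Nat.exists_eq_succ_of_ne_zero hpos
    have h1 : t < exitTime X j m ω := by
      have h2 := Nat.find_spec (hub t)
      rw [hm] at h2
      exact h2
    refine ⟨m, not_lt.1 (Nat.find_min (hub t) (by omega)), ?_⟩
    by_contra hlt
    exact hp ⟨m, not_lt.1 hlt, h1⟩
  · rintro ⟨m, h1, h2⟩ ⟨n, h3, h4⟩
    have hmn : m = n := eq_of_mem_Ico_of_mem_Ico (lo := fun k => startTime X j k ω)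
      (hi := fun k => exitTime X j k ω)
      (fun k => (startTime_le_entryTime h k).trans (entryTime_le_exitTime h k))
      (fun k => le_rfl) ⟨h1, h2.trans_le (entryTime_le_exitTime h m)⟩
      ⟨(startTime_le_entryTime h n).trans h3, h4⟩
    subst hmn
    exact absurd h2 (not_lt.2 h3)

lemma volume_timeSet_le (A : ℝ → Ω → Prop) (w : ℝ) (ω : Ω) :
    volume {t : ℝ | 0 ≤ t ∧ t < w ∧ A t ω} ≤ ENNReal.ofReal w := by
  calc volume {t : ℝ | 0 ≤ t ∧ t < w ∧ A t ω} ≤ volume (Set.Ico 0 w) :=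
        measure_mono fun t ht => ⟨ht.1, ht.2.1⟩
    _ = ENNReal.ofReal w := by rw [Real.volume_Ico, sub_zero]

end Paths

variable {Ω : Type*} [MeasurableSpace Ω] {Nc : ℕ} {μ : Measure Ω} {νY νZ : Measure ℝ}
  {X : Source Nc → Ω → ℝ} {j : Fin Nc} {ρ lam ε₁ ε₂ : ℝ}

/-! ### Independence of coins and durations -/

lemma IsCacheNetwork.sourceAlgebra_le (hX : IsCacheNetwork μ νY νZ X) (T : Set (Source Nc)) :
    sourceAlgebra X T ≤ ‹MeasurableSpace Ω› :=
  iSup₂_le fun s _ => (hX.measurable s).comap_le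

lemma IsCacheNetwork.indep_sourceAlgebra (hX : IsCacheNetwork μ νY νZ X) {S T : Set (Source Nc)}
    (hST : Disjoint S T) : Indep (sourceAlgebra X S) (sourceAlgebra X T) μ :=
  indep_iSup_of_disjoint (fun s => (hX.measurable s).comap_le) hX.indep.iIndep hST

lemma IsCacheNetwork.measure_inter (hX : IsCacheNetwork μ νY νZ X) {S T : Set (Source Nc)}
    (hST : Disjoint S T) {A B : Set Ω} (hA : MeasurableSet[sourceAlgebra X S] A)
    (hB : MeasurableSet[sourceAlgebra X T] B) : μ (A ∩ B) = μ A * μ B :=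
  (Indep_iff _ _ _).1 (hX.indep_sourceAlgebra hST) A B hA hB

open Classical in
lemma IsCacheNetwork.lintegral_ite_mul (hX : IsCacheNetwork μ νY νZ X) {S T : Set (Source Nc)}
    (hST : Disjoint S T) {A : Set Ω} (hA : MeasurableSet[sourceAlgebra X S] A) {g : Ω → ℝ≥0∞}
    (hg : Measurable[sourceAlgebra X T] g) :
    ∫⁻ ω, (if ω ∈ A then 1 else 0) * g ω ∂μ = μ A * ∫⁻ ω, g ω ∂μ := by
  have hf : Measurable[sourceAlgebra X S] (fun ω => if ω ∈ A then (1 : ℝ≥0∞) else 0) :=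
    Measurable.ite hA measurable_const measurable_const
  rw [lintegral_mul_eq_lintegral_mul_lintegral_of_independent_measurableSpace
    (hX.sourceAlgebra_le S) (hX.sourceAlgebra_le T) (hX.indep_sourceAlgebra hST) hf hg]
  congr 1
  have h := lintegral_indicator_one (μ := μ) (hX.sourceAlgebra_le S _ hA)
  rw [← h]
  refine lintegral_congr fun ω => ?_
  simp [Set.indicator_apply]

lemma uniformLaw_Iio {p : ℝ} (hp : p ∈ Set.Icc (0 : ℝ) 1) :
    uniformLaw (Set.Iio p) = ENNReal.ofReal p := by
  have h : Set.Iio p ∩ Set.Icc 0 1 = Set.Ico 0 p := by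
    ext x
    simp only [Set.mem_inter_iff, Set.mem_Iio, Set.mem_Icc, Set.mem_Ico]
    exact ⟨fun h => ⟨h.2.1, h.1⟩, fun h => ⟨h.2, h.1, h.2.le.trans hp.2⟩⟩
  rw [uniformLaw, Measure.restrict_apply measurableSet_Iio, h, Real.volume_Ico, sub_zero]

lemma IsCacheNetwork.measure_coin_lt (hX : IsCacheNetwork μ νY νZ X) {s : Source Nc}
    (hs : μ.map (X s) = uniformLaw) (p : Set.Icc (0 : ℝ) 1) :
    μ {ω | X s ω < p} = ENNReal.ofReal p := by
  rw [← uniformLaw_Iio p.2, ← hs, Measure.map_apply (hX.measurable s) measurableSet_Iio]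
  rfl

lemma IsCacheNetwork.measure_entryReported (hX : IsCacheNetwork μ νY νZ X) (P : Policy Nc)
    (j : Fin Nc) (m : ℕ) :
    μ {ω | EntryReported P X j m ω} = ENNReal.ofReal (P.entryProb j) :=
  hX.measure_coin_lt (hX.law_entryCoin j m) _

lemma IsCacheNetwork.measure_exitReported (hX : IsCacheNetwork μ νY νZ X) (P : Policy Nc)
    (j : Fin Nc) (m : ℕ) :
    μ {ω | ExitReported P X j m ω} = ENNReal.ofReal (P.exitProb j) :=
  hX.measure_coin_lt (hX.law_exitCoin j m) _

/-! ### Law of the belief -/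

lemma IsCacheNetwork.real_not_believedDuringPresence [IsProbabilityMeasure μ]
    (hX : IsCacheNetwork μ νY νZ X) (P : Policy Nc) (j : Fin Nc) (m : ℕ) :
    μ.real {ω | ¬ BelievedDuringPresence P X j m ω} =
      (1 - P.entryProb j) * (1 - μ.real {ω | BelievedDuringAbsence P X j m ω}) := by
  have hE := measurableSet_entryReported P X j m
  have hA := measurableSet_believedDuringAbsence P X j m
  have hd : Disjoint {Source.entryCoin j m} (coinsBefore j m) := by
    rw [Set.disjoint_singleton_left]
    rintro (hs | ⟨k, hk, hs | hs⟩)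
    · simp at hs
    · simp only [Source.entryCoin.injEq, true_and] at hs
      omega
    · simp at hs
  have hset : {ω | ¬ BelievedDuringPresence P X j m ω} =
      {ω | EntryReported P X j m ω}ᶜ ∩ {ω | BelievedDuringAbsence P X j m ω}ᶜ := by
    ext ω
    simp [BelievedDuringPresence]
  rw [hset, Measure.real, hX.measure_inter hd (MeasurableSet.compl hE) (MeasurableSet.compl hA),
    ENNReal.toReal_mul]
  change μ.real _ * μ.real _ = _
  rw [probReal_compl_eq_one_sub (hX.sourceAlgebra_le _ _ hE),
    probReal_compl_eq_one_sub (hX.sourceAlgebra_le _ _ hA), Measure.real,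
    hX.measure_entryReported, ENNReal.toReal_ofReal (P.entryProb j).2.1]

lemma IsCacheNetwork.real_believedDuringAbsence [IsProbabilityMeasure μ]
    (hX : IsCacheNetwork μ νY νZ X) (P : Policy Nc) (j : Fin Nc) (m : ℕ) :
    μ.real {ω | BelievedDuringAbsence P X j m ω} =
      beliefProb (P.entryProb j) (P.exitProb j) (P.initProb j) m := by
  induction m with
  | zero =>
    change μ.real {ω | X (.initCoin j) ω < P.initProb j} = _
    rw [Measure.real, hX.measure_coin_lt (hX.law_initCoin j),
      ENNReal.toReal_ofReal (P.initProb j).2.1, beliefProb]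
  | succ m ih =>
    have hE := measurableSet_exitReported P X j m
    have hB := measurableSet_believedDuringPresence P X j m
    have hset : {ω | BelievedDuringAbsence P X j (m + 1) ω} =
        {ω | ExitReported P X j m ω}ᶜ ∩ {ω | BelievedDuringPresence P X j m ω} := rfl
    have hB' : μ.real {ω | BelievedDuringPresence P X j m ω} =
        1 - μ.real {ω | ¬ BelievedDuringPresence P X j m ω} := by
      have h := probReal_compl_eq_one_sub (μ := μ) (hX.sourceAlgebra_le _ _ hB)
      change μ.real {ω | ¬ BelievedDuringPresence P X j m ω} = _ at h
      linarith
    rw [hset, Measure.real, hX.measure_inter Set.disjoint_sdiff_right (MeasurableSet.compl hE) hB,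
      ENNReal.toReal_mul]
    change μ.real _ * μ.real _ = _
    rw [probReal_compl_eq_one_sub (hX.sourceAlgebra_le _ _ hE), hB',
      hX.real_not_believedDuringPresence, ih, Measure.real, hX.measure_exitReported,
      ENNReal.toReal_ofReal (P.exitProb j).2.1, beliefProb]

/-! ### Almost sure properties of the durations -/

lemma IsDurationLaw.ae_pos {ν : Measure ℝ} (hν : IsDurationLaw ν) {f : Ω → ℝ}
    (hf : Measurable f) (h : μ.map f = ν) : ∀ᵐ ω ∂μ, 0 < f ω := by
  have h0 := hν.pos
  rw [← h, Measure.map_apply hf measurableSet_Iic] at h0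
  rw [ae_iff]
  convert h0 using 2
  ext ω
  simp

lemma IsDurationLaw.lintegral_ofReal_ne_top {ν : Measure ℝ} (hν : IsDurationLaw ν) :
    ∫⁻ x, ENNReal.ofReal x ∂ν ≠ ∞ :=
  hν.integrable.lintegral_lt_top.ne

lemma lintegral_ofReal_eq {ν : Measure ℝ} {f : Ω → ℝ} (hf : Measurable f) (h : μ.map f = ν) :
    ∫⁻ ω, ENNReal.ofReal (f ω) ∂μ = ∫⁻ x, ENNReal.ofReal x ∂ν := by
  rw [← h, lintegral_map ENNReal.measurable_ofReal hf]

lemma IsCacheNetwork.ae_durations_pos (hX : IsCacheNetwork μ νY νZ X) (hY : IsDurationLaw νY)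
    (hZ : IsDurationLaw νZ) (j : Fin Nc) :
    ∀ᵐ ω ∂μ, ∀ m, 0 < X (.absence j m) ω ∧ 0 < X (.presence j m) ω :=
  ae_all_iff.2 fun m => (hY.ae_pos (hX.measurable _) (hX.law_absence j m)).and
    (hZ.ae_pos (hX.measurable _) (hX.law_presence j m))

/-! ### Expected time spent in marked periods -/

/-- If the `m`-th interval counts only when an event that is independent of the durations
occurs, then its expected contribution is multiplied by the probability of that event. -/
lemma IsCacheNetwork.expectedTime_eq_tsum (hX : IsCacheNetwork μ νY νZ X) {lo hi : ℕ → Ω → ℝ}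
    (hlo : ∀ m, Measurable[sourceAlgebra X (durationSources j)] (lo m))
    (hhi : ∀ m, Measurable[sourceAlgebra X (durationSources j)] (hi m))
    (hord : ∀ᵐ ω ∂μ, ∀ m, lo m ω ≤ hi m ω ∧ hi m ω ≤ lo (m + 1) ω)
    {Q : ℕ → Ω → Prop} {S : ℕ → Set (Source Nc)} (hS : ∀ m, Disjoint (S m) (durationSources j))
    (hQ : ∀ m, MeasurableSet[sourceAlgebra X (S m)] {ω | Q m ω}) {A : ℝ → Ω → Prop}
    (hA : ∀ᵐ ω ∂μ, ∀ t, 0 ≤ t → (A t ω ↔ ∃ m, lo m ω ≤ t ∧ t < hi m ω ∧ Q m ω)) (w : ℝ) :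
    expectedTime μ A w = ∑' m, μ {ω | Q m ω} *
      ∫⁻ ω, volume (Set.Ico 0 w ∩ Set.Ico (lo m ω) (hi m ω)) ∂μ := by
  classical
  have hvol : ∀ m, Measurable[sourceAlgebra X (durationSources j)]
      (fun ω => volume (Set.Ico 0 w ∩ Set.Ico (lo m ω) (hi m ω))) := by
    intro m
    simp only [Set.Ico_inter_Ico, Real.volume_Ico]
    exact ((measurable_const.min (hhi m)).sub (measurable_const.max (hlo m))).ennreal_ofReal
  have h1 : expectedTime μ A w = ∫⁻ ω, ∑' m, (if ω ∈ {ω | Q m ω} then 1 else 0) *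
      volume (Set.Ico 0 w ∩ Set.Ico (lo m ω) (hi m ω)) ∂μ := by
    refine lintegral_congr_ae ?_
    filter_upwards [hord, hA] with ω hω hAω
    have h := volume_setOf_exists_mem_Ico (lo := fun m => lo m ω) (hi := fun m => hi m ω)
      (fun m => (hω m).1) (fun m => (hω m).2) (fun m => Q m ω) w
    refine Eq.trans (congrArg volume ?_) h
    ext t
    exact and_congr_right fun h0 => and_congr_right fun _ => hAω t h0
  rw [h1, lintegral_tsum]
  · exact tsum_congr fun m => hX.lintegral_ite_mul (hS m) (hQ m) (hvol m)
  · intro m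
    exact ((Measurable.ite (hX.sourceAlgebra_le _ _ (hQ m)) measurable_const
      measurable_const).mul ((hvol m).mono (hX.sourceAlgebra_le _) le_rfl)).aemeasurable

/-- If the marks are independent of the durations and their probabilities converge to `γ`, then
the marked periods take up the fraction `γ` of the long-run time in all periods. -/
lemma IsCacheNetwork.hasLongRunProb_marked [IsProbabilityMeasure μ]
    (hX : IsCacheNetwork μ νY νZ X) {lo hi : ℕ → Ω → ℝ}
    (hlo : ∀ m, Measurable[sourceAlgebra X (durationSources j)] (lo m))
    (hhi : ∀ m, Measurable[sourceAlgebra X (durationSources j)] (hi m))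
    (hord : ∀ᵐ ω ∂μ, ∀ m, lo m ω ≤ hi m ω ∧ hi m ω ≤ lo (m + 1) ω)
    {K : ℝ≥0∞} (hK : K ≠ ∞) (hlen : ∀ m, ∫⁻ ω, ENNReal.ofReal (hi m ω - lo m ω) ∂μ ≤ K)
    {B : ℝ → Ω → Prop} {τ : ℝ} (hB : HasLongRunProb μ B τ)
    (hB' : ∀ᵐ ω ∂μ, ∀ t, 0 ≤ t → (B t ω ↔ ∃ m, lo m ω ≤ t ∧ t < hi m ω))
    {Q : ℕ → Ω → Prop} {S : ℕ → Set (Source Nc)} (hS : ∀ m, Disjoint (S m) (durationSources j))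
    (hQ : ∀ m, MeasurableSet[sourceAlgebra X (S m)] {ω | Q m ω}) {γ : ℝ}
    (hγ : Tendsto (fun m => μ.real {ω | Q m ω}) atTop (𝓝 γ)) {A : ℝ → Ω → Prop}
    (hA : ∀ᵐ ω ∂μ, ∀ t, 0 ≤ t → (A t ω ↔ ∃ m, lo m ω ≤ t ∧ t < hi m ω ∧ Q m ω)) :
    HasLongRunProb μ A (γ * τ) := by
  have hγ0 : 0 ≤ γ := ge_of_tendsto' hγ fun m => measureReal_nonneg
  refine ⟨mul_nonneg hγ0 hB.1, ?_⟩
  have hBsum : ∀ w, expectedTime μ B w =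
      ∑' m, ∫⁻ ω, volume (Set.Ico 0 w ∩ Set.Ico (lo m ω) (hi m ω)) ∂μ := by
    intro w
    rw [hX.expectedTime_eq_tsum (j := j) hlo hhi hord (Q := fun _ _ => True) (S := fun _ => ∅)
      (fun _ => Set.empty_disjoint _) (fun _ => @MeasurableSet.univ _ (sourceAlgebra X ∅))
      (hB'.mono fun ω h t ht => by simpa using h t ht) w]
    refine tsum_congr fun m => ?_
    have hu : μ {ω : Ω | True} = 1 := measure_univ (μ := μ)
    rw [hu, one_mul]
  have hlim := hB.2
  simp only [hBsum] at hlim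
  simp only [hX.expectedTime_eq_tsum (j := j) hlo hhi hord hS hQ hA]
  rw [ENNReal.ofReal_mul hγ0]
  refine tendsto_tsum_mul_div (fun m => prob_le_one) ?_ hK (fun m w => ?_) ENNReal.ofReal_ne_top
    hlim
  · simpa [Measure.real] using ENNReal.tendsto_ofReal hγ
  · refine (lintegral_mono fun ω => ?_).trans (hlen m)
    exact (measure_mono Set.inter_subset_right).trans_eq Real.volume_Ico

lemma IsCacheNetwork.measurable_startTime (hX : IsCacheNetwork μ νY νZ X) (j : Fin Nc) (m : ℕ) :
    Measurable (startTime X j m) :=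
  CacheUpdate.measurable_startTime (fun s _ => hX.measurable s) m

lemma IsCacheNetwork.measurable_entryTime (hX : IsCacheNetwork μ νY νZ X) (j : Fin Nc) (m : ℕ) :
    Measurable (entryTime X j m) :=
  CacheUpdate.measurable_entryTime (fun s _ => hX.measurable s) m

/-! ### Entry and exit counts -/

lemma measurable_tsum_indicator {s : ℕ → Set Ω} (hs : ∀ m, MeasurableSet (s m)) :
    Measurable (fun ω => ∑' m, Set.indicator (s m) (1 : Ω → ℝ≥0∞) ω) :=
  Measurable.tsum fun m => measurable_one.indicator (hs m)

lemma lintegral_tsum_indicator {s : ℕ → Set Ω} (hs : ∀ m, MeasurableSet (s m)) :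
    ∫⁻ ω, ∑' m, Set.indicator (s m) (1 : Ω → ℝ≥0∞) ω ∂μ = ∑' m, μ (s m) := by
  rw [lintegral_tsum fun m => (measurable_one.indicator (hs m)).aemeasurable]
  exact tsum_congr fun m => lintegral_indicator_one (hs m)

lemma expectedTime_le [IsProbabilityMeasure μ] (A : ℝ → Ω → Prop) (w : ℝ) :
    expectedTime μ A w ≤ ENNReal.ofReal w := by
  calc expectedTime μ A w ≤ ∫⁻ _, ENNReal.ofReal w ∂μ :=
        lintegral_mono fun ω => volume_timeSet_le A w ω
    _ = ENNReal.ofReal w := by simp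

/-- Eventually the entry count is the entry rate times the time of absence. The limit being finite
excludes that the quotient is `∞`, so that multiplying by the denominator is legitimate even where
that vanishes. -/
lemma HasEntryRate.eventually_lintegral_eq [IsProbabilityMeasure μ]
    (hlam : HasEntryRate μ X j lam) :
    ∀ᶠ w : ℝ in atTop, ((∫⁻ ω, entryCount X j w ω ∂μ) /
        expectedTime μ (fun t ω => ¬ Present X j t ω) w ≠ ∞) ∧
      ∫⁻ ω, entryCount X j w ω ∂μ = (∫⁻ ω, entryCount X j w ω ∂μ) /
        expectedTime μ (fun t ω => ¬ Present X j t ω) w *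
        expectedTime μ (fun t ω => ¬ Present X j t ω) w := by
  filter_upwards [hlam.2.eventually_lt_const ENNReal.ofReal_lt_top] with w hw
  refine ⟨hw.ne, ?_⟩
  have htop : expectedTime μ (fun t ω => ¬ Present X j t ω) w ≠ ∞ :=
    ne_top_of_le_ne_top ENNReal.ofReal_ne_top (expectedTime_le _ w)
  refine (ENNReal.div_mul_cancel' (fun h0 => ?_) fun h => absurd h htop).symm
  by_contra hne
  rw [h0, ENNReal.div_zero hne] at hw
  exact absurd hw (lt_irrefl _)

/-- A finite entry rate means that entries do not accumulate. -/
lemma IsCacheNetwork.ae_startTime_unbounded [IsProbabilityMeasure μ]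
    (hX : IsCacheNetwork μ νY νZ X) (hY : IsDurationLaw νY) (hZ : IsDurationLaw νZ)
    (hlam : HasEntryRate μ X j lam) : ∀ᵐ ω ∂μ, ∀ t : ℝ, ∃ m, t < startTime X j m ω := by
  have hfin : ∀ᶠ n : ℕ in atTop, ∀ᵐ ω ∂μ, entryCount X j n ω ≠ ∞ := by
    filter_upwards [tendsto_natCast_atTop_atTop.eventually hlam.eventually_lintegral_eq]
      with n hn
    have hlt : ∫⁻ ω, entryCount X j n ω ∂μ ≠ ∞ := by
      rw [hn.2]
      exact ENNReal.mul_ne_top hn.1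
        (ne_top_of_le_ne_top ENNReal.ofReal_ne_top (expectedTime_le _ _))
    have hmeas : Measurable (fun ω => entryCount X j n ω) :=
      measurable_tsum_indicator fun m => measurableSet_le (hX.measurable_entryTime j m)
        measurable_const
    exact (ae_lt_top hmeas hlt).mono fun ω h => h.ne
  obtain ⟨N, hN⟩ := eventually_atTop.1 hfin
  have hall : ∀ᵐ ω ∂μ, ∀ n : ℕ, N ≤ n → entryCount X j n ω ≠ ∞ :=
    ae_all_iff.2 fun n => ae_all_iff.2 fun hn => hN n hn
  filter_upwards [hall, hX.ae_durations_pos hY hZ j] with ω hω hpos t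
  obtain ⟨n, hn⟩ := exists_nat_ge t
  have hf := ENNReal.finite_const_le_of_tsum_ne_top (hω (max N n) (le_max_left _ _)) one_ne_zero
  obtain ⟨m, hm⟩ := hf.exists_notMem
  refine ⟨m + 1, ?_⟩
  have hgt : ((max N n : ℕ) : ℝ) < entryTime X j m ω := by
    by_contra hle
    exact hm (Set.indicator_of_mem (s := {ω' | entryTime X j m ω' ≤ ((max N n : ℕ) : ℝ)})
      (not_lt.1 hle) (1 : Ω → ℝ≥0∞)).ge
  calc t ≤ n := hn
    _ ≤ ((max N n : ℕ) : ℝ) := by exact_mod_cast le_max_right N n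
    _ < entryTime X j m ω := hgt
    _ ≤ _ := entryTime_le_exitTime hpos m

/-! ### Distortions of a policy -/

lemma HasLongRunProb.le_one [IsProbabilityMeasure μ] {A : ℝ → Ω → Prop} {p : ℝ}
    (h : HasLongRunProb μ A p) : p ≤ 1 := by
  rw [← ENNReal.ofReal_le_one]
  refine le_of_tendsto' h.2 fun w => ?_
  exact (ENNReal.div_le_div_right (expectedTime_le A w) _).trans ENNReal.div_self_le_one

lemma HasLongRunProb.unique {A : ℝ → Ω → Prop} {p p' : ℝ} (h : HasLongRunProb μ A p)
    (h' : HasLongRunProb μ A p') : p = p' :=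
  (ENNReal.ofReal_eq_ofReal_iff h.1 h'.1).1 (tendsto_nhds_unique h.2 h'.2)

lemma HasTotalUpdateRate.unique {P : Policy Nc} {R R' : ℝ} (h : HasTotalUpdateRate μ P X R)
    (h' : HasTotalUpdateRate μ P X R') : R = R' :=
  (ENNReal.ofReal_eq_ofReal_iff h.1 h'.1).1 (tendsto_nhds_unique h.2 h'.2)

lemma IsCacheNetwork.ae_entry_exit_ordered (hX : IsCacheNetwork μ νY νZ X)
    (hY : IsDurationLaw νY) (hZ : IsDurationLaw νZ) (j : Fin Nc) :
    ∀ᵐ ω ∂μ, ∀ m, entryTime X j m ω ≤ exitTime X j m ω ∧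
      exitTime X j m ω ≤ entryTime X j (m + 1) ω :=
  (hX.ae_durations_pos hY hZ j).mono fun _ h m =>
    ⟨entryTime_le_exitTime h m, exitTime_le_entryTime_succ h m⟩

lemma IsCacheNetwork.ae_start_entry_ordered (hX : IsCacheNetwork μ νY νZ X)
    (hY : IsDurationLaw νY) (hZ : IsDurationLaw νZ) (j : Fin Nc) :
    ∀ᵐ ω ∂μ, ∀ m, startTime X j m ω ≤ entryTime X j m ω ∧
      entryTime X j m ω ≤ startTime X j (m + 1) ω :=
  (hX.ae_durations_pos hY hZ j).mono fun _ h m =>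
    ⟨startTime_le_entryTime h m, entryTime_le_exitTime h m⟩

lemma hasLongRunProb_not_present [IsProbabilityMeasure μ] (hX : IsCacheNetwork μ νY νZ X)
    (hY : IsDurationLaw νY) (hZ : IsDurationLaw νZ) (hρ : HasLongRunProb μ (Present X j) ρ) :
    HasLongRunProb μ (fun t ω => ¬ Present X j t ω) (1 - ρ) := by
  refine ⟨sub_nonneg.2 hρ.le_one, ?_⟩
  have hsum : ∀ w : ℝ, expectedTime μ (fun t ω => ¬ Present X j t ω) w =
      ENNReal.ofReal w - expectedTime μ (Present X j) w := by
    intro w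
    have hcompl : ∀ ω, volume {t : ℝ | 0 ≤ t ∧ t < w ∧ ¬ Present X j t ω} =
        ENNReal.ofReal w - volume {t : ℝ | 0 ≤ t ∧ t < w ∧ Present X j t ω} := by
      intro ω
      have hset : {t : ℝ | Present X j t ω} =
          ⋃ m, Set.Ico (entryTime X j m ω) (exitTime X j m ω) := by
        ext t
        simp [Present]
      have hmeas : MeasurableSet {t : ℝ | Present X j t ω} := by
        rw [hset]
        exact MeasurableSet.iUnion fun m => measurableSet_Ico
      have h := measure_inter_add_sdiff (μ := volume) (Set.Ico 0 w) hmeas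
      rw [Real.volume_Ico, sub_zero] at h
      have h1 : Set.Ico 0 w ∩ {t : ℝ | Present X j t ω} =
          {t : ℝ | 0 ≤ t ∧ t < w ∧ Present X j t ω} := by
        ext t
        exact and_assoc
      have h2 : Set.Ico 0 w \ {t : ℝ | Present X j t ω} =
          {t : ℝ | 0 ≤ t ∧ t < w ∧ ¬ Present X j t ω} := by
        ext t
        exact and_assoc
      rw [h1, h2] at h
      exact ENNReal.eq_sub_of_add_eq' ENNReal.ofReal_ne_top ((add_comm _ _).trans h)
    have hae : AEMeasurable (fun ω => volume {t : ℝ | 0 ≤ t ∧ t < w ∧ Present X j t ω}) μ := by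
      refine ⟨fun ω => ∑' m, volume (Set.Ico 0 w ∩
        Set.Ico (entryTime X j m ω) (exitTime X j m ω)), Measurable.tsum fun m => ?_, ?_⟩
      · simp only [Set.Ico_inter_Ico, Real.volume_Ico]
        exact ((measurable_const.min (hX.measurable_startTime j (m + 1))).sub
          (measurable_const.max (hX.measurable_entryTime j m))).ennreal_ofReal
      · filter_upwards [hX.ae_entry_exit_ordered hY hZ j] with ω hω
        have h := volume_setOf_exists_mem_Ico (lo := fun m => entryTime X j m ω)
          (hi := fun m => exitTime X j m ω) (fun m => (hω m).1) (fun m => (hω m).2)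
          (fun _ => True) w
        simpa [Present] using h
    rw [expectedTime, expectedTime, lintegral_congr hcompl,
      lintegral_sub' hae (ne_top_of_le_ne_top ENNReal.ofReal_ne_top
        (expectedTime_le (μ := μ) (Present X j) w))
      (Eventually.of_forall fun ω => volume_timeSet_le _ w ω)]
    simp
  have h := ENNReal.Tendsto.sub (tendsto_const_nhds (x := (1 : ℝ≥0∞))) hρ.2
    (Or.inl ENNReal.one_ne_top)
  rw [← ENNReal.ofReal_one, ← ENNReal.ofReal_sub _ hρ.1] at h
  refine h.congr' ?_
  filter_upwards [eventually_gt_atTop 0] with w hw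
  have hw0 : ENNReal.ofReal w ≠ 0 := by simpa using hw
  rw [hsum, ENNReal.sub_div fun _ _ => hw0, ENNReal.div_self hw0 ENNReal.ofReal_ne_top,
    ENNReal.ofReal_one]

lemma hasDistortionI [IsProbabilityMeasure μ] (hX : IsCacheNetwork μ νY νZ X)
    (hY : IsDurationLaw νY) (hZ : IsDurationLaw νZ) (hρ : HasLongRunProb μ (Present X j) ρ)
    (P : Policy Nc) {α : ℝ}
    (hα : Tendsto (beliefProb (P.entryProb j) (P.exitProb j) (P.initProb j)) atTop (𝓝 α)) :
    HasDistortionI μ P X j ((1 - P.entryProb j) * (1 - α) * ρ) := by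
  refine hX.hasLongRunProb_marked (j := j) (lo := entryTime X j) (hi := exitTime X j)
    (Q := fun m ω => ¬ BelievedDuringPresence P X j m ω)
    (S := fun m => coinsBefore j (m + 1) \ {.exitCoin j m})
    (CacheUpdate.measurable_entryTime fun s hs => measurable_source X hs)
    (fun m => CacheUpdate.measurable_startTime (fun s hs => measurable_source X hs) (m + 1))
    (hX.ae_entry_exit_ordered hY hZ j)
    hZ.lintegral_ofReal_ne_top (fun m => ?_) hρ
    (Eventually.of_forall fun ω t _ => Iff.rfl)
    (fun m => (disjoint_coinsBefore_durationSources j (m + 1)).mono_left Set.sdiff_subset)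
    (fun m => MeasurableSet.compl (measurableSet_believedDuringPresence P X j m)) ?_
    ((hX.ae_durations_pos hY hZ j).mono fun ω h t _ => present_and_not_believed_iff h t)
  · simp only [exitTime_eq, add_sub_cancel_left]
    exact (lintegral_ofReal_eq (hX.measurable _) (hX.law_presence j m)).le
  · simp only [hX.real_not_believedDuringPresence, hX.real_believedDuringAbsence]
    exact (hα.const_sub 1).const_mul _

lemma hasDistortionII [IsProbabilityMeasure μ] (hX : IsCacheNetwork μ νY νZ X)
    (hY : IsDurationLaw νY) (hZ : IsDurationLaw νZ) (hρ : HasLongRunProb μ (Present X j) ρ)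
    (hlam : HasEntryRate μ X j lam) (P : Policy Nc) {α : ℝ}
    (hα : Tendsto (beliefProb (P.entryProb j) (P.exitProb j) (P.initProb j)) atTop (𝓝 α)) :
    HasDistortionII μ P X j (α * (1 - ρ)) := by
  refine hX.hasLongRunProb_marked (j := j) (lo := startTime X j) (hi := entryTime X j)
    (S := coinsBefore j)
    (CacheUpdate.measurable_startTime fun s hs => measurable_source X hs)
    (CacheUpdate.measurable_entryTime fun s hs => measurable_source X hs)
    (hX.ae_start_entry_ordered hY hZ j)
    hY.lintegral_ofReal_ne_top (fun m => ?_)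
    (hasLongRunProb_not_present hX hY hZ hρ) ?_
    (disjoint_coinsBefore_durationSources j) (measurableSet_believedDuringAbsence P X j) ?_
    ((hX.ae_durations_pos hY hZ j).mono fun ω h t _ => not_present_and_believed_iff h t)
  · simp only [entryTime, add_sub_cancel_left]
    exact (lintegral_ofReal_eq (hX.measurable _) (hX.law_absence j m)).le
  · filter_upwards [hX.ae_durations_pos hY hZ j, hX.ae_startTime_unbounded hY hZ hlam]
      with ω h hub t ht using not_present_iff h hub ht
  · simpa only [hX.real_believedDuringAbsence] using hα

/-! ### Update rate of a policy -/

lemma tendsto_lintegral_entryCount [IsProbabilityMeasure μ] (hX : IsCacheNetwork μ νY νZ X)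
    (hY : IsDurationLaw νY) (hZ : IsDurationLaw νZ) (hρ : HasLongRunProb μ (Present X j) ρ)
    (hlam : HasEntryRate μ X j lam) :
    Tendsto (fun w : ℝ => (∫⁻ ω, entryCount X j w ω ∂μ) / ENNReal.ofReal w) atTop
      (𝓝 (ENNReal.ofReal (lam * (1 - ρ)))) := by
  have h := ENNReal.Tendsto.mul hlam.2 (Or.inr ENNReal.ofReal_ne_top)
    (hasLongRunProb_not_present hX hY hZ hρ).2 (Or.inr ENNReal.ofReal_ne_top)
  rw [← ENNReal.ofReal_mul hlam.1] at h
  refine h.congr' ?_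
  filter_upwards [hlam.eventually_lintegral_eq] with w hw
  rw [← mul_div_assoc, ← hw.2]

/-- Number of exits from cache `j` up to time `w`. -/
noncomputable def exitCount (X : Source Nc → Ω → ℝ) (j : Fin Nc) (w : ℝ) (ω : Ω) : ℝ≥0∞ :=
  ∑' m, Set.indicator {ω' | exitTime X j m ω' ≤ w} 1 ω

lemma indicator_one_le {α : Type*} {s t : Set α} {a : α} (h : a ∈ s → a ∈ t) :
    s.indicator (1 : α → ℝ≥0∞) a ≤ t.indicator 1 a := by
  by_cases hs : a ∈ s
  · rw [Set.indicator_of_mem hs, Set.indicator_of_mem (h hs)]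
  · rw [Set.indicator_of_notMem hs]
    exact zero_le

/-- Entries and exits alternate, so their counts differ by at most one. -/
lemma tendsto_lintegral_exitCount [IsProbabilityMeasure μ] (hX : IsCacheNetwork μ νY νZ X)
    (hY : IsDurationLaw νY) (hZ : IsDurationLaw νZ) (hρ : HasLongRunProb μ (Present X j) ρ)
    (hlam : HasEntryRate μ X j lam) :
    Tendsto (fun w : ℝ => (∫⁻ ω, exitCount X j w ω ∂μ) / ENNReal.ofReal w) atTop
      (𝓝 (ENNReal.ofReal (lam * (1 - ρ)))) := by
  have hen := tendsto_lintegral_entryCount hX hY hZ hρ hlam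
  have hlow := ENNReal.Tendsto.sub hen (tendsto_const_div_ofReal ENNReal.one_ne_top)
    (Or.inr ENNReal.zero_ne_top)
  rw [tsub_zero] at hlow
  refine tendsto_of_tendsto_of_tendsto_of_le_of_le hlow hen (fun w => ?_) (fun w => ?_)
  · refine tsub_le_iff_right.2 ?_
    rw [← ENNReal.add_div]
    refine ENNReal.div_le_div_right ?_ _
    calc ∫⁻ ω, entryCount X j w ω ∂μ ≤ ∫⁻ ω, exitCount X j w ω + 1 ∂μ := by
          refine lintegral_mono_ae ?_
          filter_upwards [hX.ae_durations_pos hY hZ j] with ω hω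
          rw [entryCount, tsum_eq_zero_add' ENNReal.summable, add_comm]
          refine add_le_add (ENNReal.tsum_le_tsum fun m => indicator_one_le fun h =>
            (exitTime_le_entryTime_succ hω m).trans h) (Set.indicator_le_self _ _ _)
      _ = _ := by rw [lintegral_add_right _ measurable_const]; simp
  · refine ENNReal.div_le_div_right (lintegral_mono_ae ?_) _
    filter_upwards [hX.ae_durations_pos hY hZ j] with ω hω
    exact ENNReal.tsum_le_tsum fun m => indicator_one_le fun h =>
      (entryTime_le_exitTime hω m).trans h

/-- Counting only events of time that are marked, with probability `r` and independently of the
durations, multiplies the expected count by `r`. -/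
lemma IsCacheNetwork.lintegral_marked_count (hX : IsCacheNetwork μ νY νZ X) {T : ℕ → Ω → ℝ}
    (hT : ∀ m, Measurable[sourceAlgebra X (durationSources j)] (T m))
    {Q : ℕ → Ω → Prop} {S : ℕ → Set (Source Nc)} (hS : ∀ m, Disjoint (S m) (durationSources j))
    (hQ : ∀ m, MeasurableSet[sourceAlgebra X (S m)] {ω | Q m ω}) {r : ℝ≥0∞}
    (hr : ∀ m, μ {ω | Q m ω} = r) (w : ℝ) :
    Measurable (fun ω => ∑' m, Set.indicator {ω' | T m ω' ≤ w ∧ Q m ω'} (1 : Ω → ℝ≥0∞) ω) ∧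
    ∫⁻ ω, ∑' m, Set.indicator {ω' | T m ω' ≤ w ∧ Q m ω'} (1 : Ω → ℝ≥0∞) ω ∂μ =
      r * ∫⁻ ω, ∑' m, Set.indicator {ω' | T m ω' ≤ w} (1 : Ω → ℝ≥0∞) ω ∂μ := by
  have hT' : ∀ m, MeasurableSet[sourceAlgebra X (durationSources j)] {ω | T m ω ≤ w} :=
    fun m => hT m measurableSet_Iic
  have hT'' : ∀ m, MeasurableSet {ω | T m ω ≤ w} := fun m => hX.sourceAlgebra_le _ _ (hT' m)
  have hTQ : ∀ m, MeasurableSet {ω | T m ω ≤ w ∧ Q m ω} :=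
    fun m => (hT'' m).inter (hX.sourceAlgebra_le _ _ (hQ m))
  refine ⟨measurable_tsum_indicator hTQ, ?_⟩
  rw [lintegral_tsum_indicator hTQ, lintegral_tsum_indicator hT'', ← ENNReal.tsum_mul_left]
  refine tsum_congr fun m => ?_
  rw [mul_comm, ← hr m]
  exact hX.measure_inter (hS m).symm (hT' m) (hQ m)

lemma measurable_and_lintegral_updateCount (hX : IsCacheNetwork μ νY νZ X) (P : Policy Nc)
    (j : Fin Nc) (w : ℝ) : Measurable (updateCount P X j w) ∧ ∫⁻ ω, updateCount P X j w ω ∂μ =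
      ENNReal.ofReal (P.entryProb j) * ∫⁻ ω, entryCount X j w ω ∂μ +
        ENNReal.ofReal (P.exitProb j) * ∫⁻ ω, exitCount X j w ω ∂μ := by
  have hen := hX.lintegral_marked_count (j := j) (T := entryTime X j)
    (CacheUpdate.measurable_entryTime fun s hs => measurable_source X hs)
    (Q := EntryReported P X j) (S := fun m => ({Source.entryCoin j m} : Set (Source Nc)))
    (fun m => by simp [durationSources]) (fun m => measurableSet_entryReported P X j m)
    (r := ENNReal.ofReal (P.entryProb j)) (fun m => hX.measure_entryReported P j m) w
  have hex := hX.lintegral_marked_count (j := j) (T := exitTime X j)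
    (fun m => CacheUpdate.measurable_startTime (fun s hs => measurable_source X hs) (m + 1))
    (Q := ExitReported P X j) (S := fun m => ({Source.exitCoin j m} : Set (Source Nc)))
    (fun m => by simp [durationSources]) (fun m => measurableSet_exitReported P X j m)
    (r := ENNReal.ofReal (P.exitProb j)) (fun m => hX.measure_exitReported P j m) w
  obtain ⟨hm1, h1⟩ := hen
  obtain ⟨hm2, h2⟩ := hex
  refine ⟨hm1.add hm2, ?_⟩
  simp only [updateCount, entryCount, exitCount]
  rw [lintegral_add_left hm1, h1, h2]

lemma hasTotalUpdateRate [IsProbabilityMeasure μ] (hX : IsCacheNetwork μ νY νZ X)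
    (hY : IsDurationLaw νY) (hZ : IsDurationLaw νZ)
    (hρ : ∀ j, HasLongRunProb μ (Present X j) ρ)
    (hlam : ∀ j, HasEntryRate μ X j lam) (P : Policy Nc) :
    HasTotalUpdateRate μ P X
      (∑ j, ((P.entryProb j : ℝ) + P.exitProb j) * (lam * (1 - ρ))) := by
  have hc : ∀ j : Fin Nc, 0 ≤ lam * (1 - ρ) := fun j =>
    mul_nonneg (hlam j).1 (sub_nonneg.2 (hρ j).le_one)
  have hp : ∀ j, 0 ≤ (P.entryProb j : ℝ) := fun j => (P.entryProb j).2.1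
  have hq : ∀ j, 0 ≤ (P.exitProb j : ℝ) := fun j => (P.exitProb j).2.1
  have hterm : ∀ j, 0 ≤ ((P.entryProb j : ℝ) + P.exitProb j) * (lam * (1 - ρ)) := fun j =>
    mul_nonneg (add_nonneg (hp j) (hq j)) (hc j)
  refine ⟨Finset.sum_nonneg fun j _ => hterm j, ?_⟩
  rw [ENNReal.ofReal_sum_of_nonneg fun j _ => hterm j]
  have hsum := tendsto_finsetSum (Finset.univ : Finset (Fin Nc)) fun j _ =>
    (ENNReal.Tendsto.const_mul (a := ENNReal.ofReal (P.entryProb j))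
      (tendsto_lintegral_entryCount hX hY hZ (hρ j) (hlam j))
        (Or.inr ENNReal.ofReal_ne_top)).add
    (ENNReal.Tendsto.const_mul (a := ENNReal.ofReal (P.exitProb j))
      (tendsto_lintegral_exitCount hX hY hZ (hρ j) (hlam j)) (Or.inr ENNReal.ofReal_ne_top))
  convert hsum using 2 with w
  · rw [lintegral_finsetSum _ fun j _ => (measurable_and_lintegral_updateCount hX P j w).1,
      div_eq_mul_inv, Finset.sum_mul]
    refine Finset.sum_congr rfl fun j _ => ?_
    rw [(measurable_and_lintegral_updateCount hX P j w).2, ← div_eq_mul_inv, ENNReal.add_div,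
      mul_div_assoc, mul_div_assoc]
  · refine Finset.sum_congr rfl fun j _ => ?_
    rw [← ENNReal.ofReal_mul (hp j), ← ENNReal.ofReal_mul (hq j),
      ← ENNReal.ofReal_add (mul_nonneg (hp j) (hc j)) (mul_nonneg (hq j) (hc j)), ← add_mul]

/-! ### Optimal policies -/

/-- Starting the belief chain at a stationary value makes the distortions explicit in terms of that
value, also where nothing is ever reported and every value is stationary. -/
lemma meetsDistortion_of_stationary [IsProbabilityMeasure μ] (hX : IsCacheNetwork μ νY νZ X)
    (hY : IsDurationLaw νY) (hZ : IsDurationLaw νZ)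
    (hρ : ∀ j, HasLongRunProb μ (Present X j) ρ) (hlam : ∀ j, HasEntryRate μ X j lam)
    {p q α : Set.Icc (0 : ℝ) 1} (hα : IsStationaryBelief p q α)
    (h1 : (1 - (p : ℝ)) * (1 - α) * ρ ≤ ε₁) (h2 : α * (1 - ρ) ≤ ε₂) :
    MeetsDistortion μ ⟨fun _ => p, fun _ => q, fun _ => α⟩ X ε₁ ε₂ := by
  intro j
  have hlim : Tendsto (beliefProb (p : ℝ) q α) atTop (𝓝 (α : ℝ)) := by
    rw [funext (beliefProb_of_stationary hα)]
    exact tendsto_const_nhds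
  exact ⟨⟨_, hasDistortionI hX hY hZ (hρ j) ⟨fun _ => p, fun _ => q, fun _ => α⟩ hlim, h1⟩,
    ⟨_, hasDistortionII hX hY hZ (hρ j) (hlam j) ⟨fun _ => p, fun _ => q, fun _ => α⟩ hlim, h2⟩⟩

/-- At each cache of a policy that meets the distortion criterion, the reporting probabilities
have at least the optimal sum. -/
lemma cost_ge_of_meetsDistortion [IsProbabilityMeasure μ] (hX : IsCacheNetwork μ νY νZ X)
    (hY : IsDurationLaw νY) (hZ : IsDurationLaw νZ)
    (hρ : ∀ j, HasLongRunProb μ (Present X j) ρ) (hlam : ∀ j, HasEntryRate μ X j lam)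
    {P : Policy Nc} (hP : MeetsDistortion μ P X ε₁ ε₂) (hρ0 : 0 < ρ) (hρ1 : ρ < 1)
    (hab : ε₁ / ρ + ε₂ / (1 - ρ) < 1) (j : Fin Nc) :
    2 - ε₁ / ρ / (1 - ε₂ / (1 - ρ)) - ε₂ / (1 - ρ) / (1 - ε₁ / ρ) ≤
      P.entryProb j + P.exitProb j := by
  have hp := (P.entryProb j).2
  have hq := (P.exitProb j).2
  obtain ⟨α, hα, hlim⟩ := exists_tendsto_beliefProb (u := P.initProb j) hp hq
  obtain ⟨⟨D₁, hD₁, hle₁⟩, D₂, hD₂, hle₂⟩ := hP j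
  rw [hD₁.unique (hasDistortionI hX hY hZ (hρ j) P hlim), ← le_div_iff₀ hρ0] at hle₁
  rw [hD₂.unique (hasDistortionII hX hY hZ (hρ j) (hlam j) P hlim),
    ← le_div_iff₀ (sub_pos.2 hρ1)] at hle₂
  have hmem : ∀ m, beliefProb (P.entryProb j) (P.exitProb j) (P.initProb j) m ∈
      Set.Icc (0 : ℝ) 1 := by
    intro m
    rw [← hX.real_believedDuringAbsence]
    exact ⟨measureReal_nonneg, measureReal_le_one⟩
  have hα01 := isClosed_Icc.mem_of_tendsto hlim (Eventually.of_forall hmem)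
  exact stationary_cost_ge hp hq hα hα01.1 hα01.2 hle₁ hle₂ hab

/-- If the criterion is loose enough, some constant belief meets it. -/
lemma exists_constant_belief (hε₁ : 0 ≤ ε₁) (hε₂ : 0 ≤ ε₂)
    (h : ¬ (ε₁ < ρ ∧ ρ < 1 - ε₂ ∧ ε₁ * (1 - ρ) + ε₂ * ρ < ρ * (1 - ρ))) :
    ∃ α : Set.Icc (0 : ℝ) 1, (1 - (α : ℝ)) * ρ ≤ ε₁ ∧ α * (1 - ρ) ≤ ε₂ := by
  by_cases h1 : ε₁ < ρ
  · by_cases h2 : ρ < 1 - ε₂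
    · have h3 : ρ * (1 - ρ) ≤ ε₁ * (1 - ρ) + ε₂ * ρ := not_lt.1 fun h3 => h ⟨h1, h2, h3⟩
      have hρ0 : 0 < ρ := hε₁.trans_lt h1
      have hle : ε₁ / ρ ≤ 1 := (div_le_one hρ0).2 h1.le
      have hge : 0 ≤ ε₁ / ρ := div_nonneg hε₁ hρ0.le
      refine ⟨⟨1 - ε₁ / ρ, by linarith, by linarith⟩, ?_, ?_⟩
      · rw [sub_sub_cancel, div_mul_cancel₀ _ hρ0.ne']
      · have h4 : (1 - ε₁ / ρ) * (1 - ρ) = (ρ - ε₁) * (1 - ρ) / ρ := by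
          field_simp
        rw [h4, div_le_iff₀ hρ0]
        linarith
    · exact ⟨⟨1, zero_le_one, le_rfl⟩, by simpa using hε₁, by simp only [one_mul]; linarith⟩
  · exact ⟨⟨0, le_rfl, zero_le_one⟩, by simpa using not_lt.1 h1, by simpa using hε₂⟩

lemma ae_updateCount_eq_zero (hX : IsCacheNetwork μ νY νZ X) {P : Policy Nc}
    (hp : ∀ j, (P.entryProb j : ℝ) = 0) (hq : ∀ j, (P.exitProb j : ℝ) = 0) :
    ∀ᵐ ω ∂μ, ∀ j w, updateCount P X j w ω = 0 := by
  have hen : ∀ᵐ ω ∂μ, ∀ j m, ¬ EntryReported P X j m ω :=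
    ae_all_iff.2 fun j => ae_all_iff.2 fun m => by
      rw [ae_iff]
      simp only [not_not]
      rw [hX.measure_entryReported, hp, ENNReal.ofReal_zero]
  have hex : ∀ᵐ ω ∂μ, ∀ j m, ¬ ExitReported P X j m ω :=
    ae_all_iff.2 fun j => ae_all_iff.2 fun m => by
      rw [ae_iff]
      simp only [not_not]
      rw [hX.measure_exitReported, hq, ENNReal.ofReal_zero]
  filter_upwards [hen, hex] with ω h1 h2 j w
  rw [updateCount, add_eq_zero, ENNReal.tsum_eq_zero, ENNReal.tsum_eq_zero]
  exact ⟨fun m => Set.indicator_of_notMem (fun h => h1 j m h.2) _,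
    fun m => Set.indicator_of_notMem (fun h => h2 j m h.2) _⟩

end CacheUpdate

theorem theorem1 {Ω : Type*} [MeasurableSpace Ω] (μ : Measure Ω) [IsProbabilityMeasure μ]
    (Nc : ℕ) (νY νZ : Measure ℝ)
    (hY : CacheUpdate.IsDurationLaw νY) (hZ : CacheUpdate.IsDurationLaw νZ)
    (X : CacheUpdate.Source Nc → Ω → ℝ) (hX : CacheUpdate.IsCacheNetwork μ νY νZ X)
    (ρ lam ε₁ ε₂ : ℝ) (hε₁ : 0 ≤ ε₁) (hε₂ : 0 ≤ ε₂)
    (hρ : ∀ j, CacheUpdate.HasLongRunProb μ (CacheUpdate.Present X j) ρ)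
    (hlam : ∀ j, CacheUpdate.HasEntryRate μ X j lam) :
    (∀ P : CacheUpdate.Policy Nc,
      (∀ j, (∃ D₁, CacheUpdate.HasDistortionI μ P X j D₁) ∧
        ∃ D₂, CacheUpdate.HasDistortionII μ P X j D₂) ∧
      ∃ R, CacheUpdate.HasTotalUpdateRate μ P X R) ∧
    ((ε₁ < ρ ∧ ρ < 1 - ε₂ ∧ ε₁ * (1 - ρ) + ε₂ * ρ < ρ * (1 - ρ)) →
      IsLeast (CacheUpdate.sufficientRates μ X ε₁ ε₂)
        (Nc * lam * (1 - ρ) *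
          (2 - ε₁ * (1 - ρ) / (ρ * (1 - ρ - ε₂)) - ε₂ * ρ / ((1 - ρ) * (ρ - ε₁))))) ∧
    (¬ (ε₁ < ρ ∧ ρ < 1 - ε₂ ∧ ε₁ * (1 - ρ) + ε₂ * ρ < ρ * (1 - ρ)) →
      IsLeast (CacheUpdate.sufficientRates μ X ε₁ ε₂) 0 ∧
      ∃ P : CacheUpdate.Policy Nc, CacheUpdate.MeetsDistortion μ P X ε₁ ε₂ ∧
        ∀ᵐ ω ∂μ, ∀ j w, CacheUpdate.updateCount P X j w ω = 0) := by
  have hlimits := fun P => CacheUpdate.hasTotalUpdateRate hX hY hZ hρ hlam P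
  refine ⟨fun P => ⟨fun j => ?_, _, hlimits P⟩, fun h => ?_, fun h => ?_⟩
  · obtain ⟨α, -, hα⟩ := CacheUpdate.exists_tendsto_beliefProb (u := P.initProb j)
      (P.entryProb j).2 (P.exitProb j).2
    exact ⟨⟨_, CacheUpdate.hasDistortionI hX hY hZ (hρ j) P hα⟩,
      ⟨_, CacheUpdate.hasDistortionII hX hY hZ (hρ j) (hlam j) P hα⟩⟩
  · obtain ⟨h1, h2, h3⟩ := h
    have hρ0 : 0 < ρ := hε₁.trans_lt h1
    have hρ1 : ρ < 1 := by linarith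
    have hρ1' : 0 < 1 - ρ := by linarith
    -- the criterion bounds the conditional error probabilities during presence and absence
    set a := ε₁ / ρ with ha_def
    set b := ε₂ / (1 - ρ) with hb_def
    have ha0 : 0 ≤ a := div_nonneg hε₁ hρ0.le
    have hb0 : 0 ≤ b := div_nonneg hε₂ hρ1'.le
    have hab : a + b < 1 := by
      rw [ha_def, hb_def, div_add_div _ _ hρ0.ne' hρ1'.ne', div_lt_one (mul_pos hρ0 hρ1')]
      linarith
    have hcost : 2 - ε₁ * (1 - ρ) / (ρ * (1 - ρ - ε₂)) - ε₂ * ρ / ((1 - ρ) * (ρ - ε₁)) =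
        2 - a / (1 - b) - b / (1 - a) := by
      have e1 : 1 - b = (1 - ρ - ε₂) / (1 - ρ) := by rw [hb_def]; field_simp
      have e2 : 1 - a = (ρ - ε₁) / ρ := by rw [ha_def]; field_simp
      rw [e1, e2, ha_def, hb_def, div_div_div_eq, div_div_div_eq]
    rw [hcost]
    constructor
    · have hb1 : 0 < 1 - b := by linarith
      have ha1 : 0 < 1 - a := by linarith
      have hp1 : a / (1 - b) ≤ 1 := (div_le_one hb1).2 (by linarith)
      have hq1 : b / (1 - a) ≤ 1 := (div_le_one ha1).2 (by linarith)
      have hp0 : 0 ≤ a / (1 - b) := div_nonneg ha0 hb1.le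
      have hq0 : 0 ≤ b / (1 - a) := div_nonneg hb0 ha1.le
      -- these probabilities, started at the stationary belief `b`, make both constraints tight
      let p : Set.Icc (0 : ℝ) 1 := ⟨1 - a / (1 - b), by linarith, by linarith⟩
      let q : Set.Icc (0 : ℝ) 1 := ⟨1 - b / (1 - a), by linarith, by linarith⟩
      let u : Set.Icc (0 : ℝ) 1 := ⟨b, hb0, by linarith⟩
      have hmiss : (1 - (p : ℝ)) * (1 - u) = a := by
        change (1 - (1 - a / (1 - b))) * (1 - b) = a
        rw [sub_sub_cancel, div_mul_cancel₀ _ hb1.ne']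
      have hu : CacheUpdate.IsStationaryBelief p q u := by
        rw [CacheUpdate.IsStationaryBelief, hmiss]
        change b = (1 - (1 - b / (1 - a))) * (1 - a)
        rw [sub_sub_cancel, div_mul_cancel₀ _ ha1.ne']
      refine ⟨⟨fun _ => p, fun _ => q, fun _ => u⟩,
        CacheUpdate.meetsDistortion_of_stationary hX hY hZ hρ hlam hu ?_ ?_, ?_⟩
      · rw [hmiss, ha_def, div_mul_cancel₀ _ hρ0.ne']
      · exact (div_mul_cancel₀ _ hρ1'.ne').le
      · convert hlimits ⟨fun _ => p, fun _ => q, fun _ => u⟩ using 1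
        change _ = ∑ _j : Fin Nc, (1 - a / (1 - b) + (1 - b / (1 - a))) * (lam * (1 - ρ))
        rw [Finset.sum_const, Finset.card_univ, Fintype.card_fin, nsmul_eq_mul]
        ring
    · rintro R ⟨P, hP, hR⟩
      rw [hR.unique (hlimits P)]
      calc _ = ∑ _j : Fin Nc, (2 - a / (1 - b) - b / (1 - a)) * (lam * (1 - ρ)) := by
            rw [Finset.sum_const, Finset.card_univ, Fintype.card_fin, nsmul_eq_mul]
            ring
        _ ≤ _ := Finset.sum_le_sum fun j _ => mul_le_mul_of_nonneg_right
            (CacheUpdate.cost_ge_of_meetsDistortion hX hY hZ hρ hlam hP hρ0 hρ1 hab j)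
            (mul_nonneg (hlam j).1 hρ1'.le)
  · obtain ⟨α, h1, h2⟩ := CacheUpdate.exists_constant_belief hε₁ hε₂ h
    let z : Set.Icc (0 : ℝ) 1 := ⟨0, le_rfl, zero_le_one⟩
    have hz : (z : ℝ) = 0 := rfl
    have hα : CacheUpdate.IsStationaryBelief z z α := by
      simp [CacheUpdate.IsStationaryBelief, hz]
    have hP : CacheUpdate.MeetsDistortion μ ⟨fun _ => z, fun _ => z, fun _ => α⟩ X ε₁ ε₂ :=
      CacheUpdate.meetsDistortion_of_stationary hX hY hZ hρ hlam hα
        (by rwa [hz, sub_zero, one_mul]) h2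
    refine ⟨⟨⟨_, hP, ?_⟩, ?_⟩, _, hP,
      CacheUpdate.ae_updateCount_eq_zero hX (fun _ => hz) fun _ => hz⟩
    · convert hlimits ⟨fun _ => z, fun _ => z, fun _ => α⟩ using 1
      simp [hz]
    · rintro R ⟨P, -, hR⟩
      exact hR.1
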